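/- All graphs are finite and simple. The threshold graph generated by a binary code $b_1b_2\cdots b_n$ has vertices $v_1,\dots,v_n$, and for $i<j$ the vertices $v_i,v_j$ are adjacent if and only if $b_j=1$ (so $v_j$ is added as an isolated vertex if $b_j=0$ and as a dominating vertex if $b_j=1$). A graph is realized by a code if it is isomorphic to the threshold graph that the code generates. A set $W$ of vertices of a graph $H$ is a resolving set if distinct vertices of $H$ have distinct vectors of distances to the elements of $W$; $\beta(H)$ is the minimum cardinality of a resolving set, and the threshold dimension $\tau(G)$ is the minimum of $\beta(H)$ over all graphs $H$ that contain $G$ as a spanning subgraph. **Theorem.** Let $s_1,t_1,s_2,t_2$ be positive integers, let $G$ be a threshold graph realized by $0^{s_1}1^{t_1}0^{s_2}1^{t_2}$, and put $m_1=t_1-2^{s_2}+1$ and $m_2=2^{s_2}-1-t_1$. (i) Let $k_1$ be the least positive integer with $s_1+t_1+s_2-k_1\le 2^{k_1}-1$. If $k_1\le s_2$ or $t_1\le 2^{s_2}-1$, then $\tau(G)=(t_2-1)+k_1$. (ii) If $t_1\ge 2^{s_2}-1$ and $k_2$ is the least positive integer with $s_1-k_2\le 2^{s_2+k_2}-2^{s_2}$,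 then $\tau(G)=(t_2-1)+s_2+m_1+k_2$. (iii) If $t_1<2^{s_2}-1$, $s_1>m_2$, and $k_2$ is the least positive integer with $s_1-m_2-k_2\le 2^{s_2+k_2}-2^{s_2}$, then $\tau(G)=(t_2-1)+s_2+k_2$. Moreover, one of the three cases always applies: the integer $k_1$ of (i) satisfies $k_1\le s_2$, or $t_1\ge 2^{s_2}-1$, or both $t_1<2^{s_2}-1$ and $s_1>m_2$, where in the case that applies the least integer $k_1$ or $k_2$ exists. -/

import Mathlib

/-- The code `0^{s₁}1^{t₁}0^{s₂}1^{t₂}`, with `false` for the bit `0` and `true` for the bit `1`. -/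
def twoStringCode (s₁ t₁ s₂ t₂ : ℕ) : List Bool :=
  List.replicate s₁ false ++ List.replicate t₁ true ++
    List.replicate s₂ false ++ List.replicate t₂ true

/-- The threshold graph `G(b)` generated by a binary code `b = b₁ ⋯ bₙ`. The vertices are added one
after another; vertex `j` is joined to no earlier vertex if its bit is `0`, and to every earlier
vertex if its bit is `1`. So two distinct vertices are adjacent iff the later one has bit `1`. -/
def codeGraph (b : List Bool) : SimpleGraph (Fin b.length) where
  Adj i j := i ≠ j ∧ b.get (max i j) = true
  symm := ⟨fun i j h => ⟨h.1.symm, by rw [max_comm]; exact h.2⟩⟩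
  loopless := ⟨fun _ h => h.1 rfl⟩

theorem codeGraph_adj_of_lt (b : List Bool) {i j : Fin b.length} (h : i < j) :
    (codeGraph b).Adj i j ↔ b.get j = true := by
  simp only [codeGraph, max_eq_right h.le, ne_eq, h.ne, not_false_eq_true, true_and]

/-- `G` is realized by the code `b`: it is (isomorphic to) the threshold graph of `b`. -/
def IsRealizedBy {V : Type*} (G : SimpleGraph V) (b : List Bool) : Prop :=
  Nonempty (G ≃g codeGraph b)

/-- `W` is a resolving set of `G`: distinct vertices have distinct vectors of distances to `W`.
The distance is taken in `ℕ∞`, so that it is meaningful for every graph. -/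
def IsResolvingSet {V : Type*} (G : SimpleGraph V) (W : Finset V) : Prop :=
  ∀ u v : V, (∀ w ∈ W, G.edist u w = G.edist v w) → u = v

theorem isResolvingSet_univ {V : Type*} [Fintype V] (G : SimpleGraph V) :
    IsResolvingSet G Finset.univ := by
  intro u v h
  have h1 := h v (Finset.mem_univ v)
  rw [SimpleGraph.edist_self] at h1
  exact SimpleGraph.edist_eq_zero_iff.mp h1

/-- The metric dimension `β(G)`: the minimum cardinality of a resolving set (the set of candidates
is nonempty for a finite graph, by `isResolvingSet_univ`). -/
noncomputable def metricDimension {V : Type*} (G : SimpleGraph V) : ℕ :=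
  sInf {n : ℕ | ∃ W : Finset V, IsResolvingSet G W ∧ W.card = n}

/-- The threshold dimension `τ(G)`: the minimum metric dimension of a graph `H` that contains `G`
as a spanning subgraph. -/
noncomputable def thresholdDimension {V : Type*} (G : SimpleGraph V) : ℕ :=
  sInf {n : ℕ | ∃ H : SimpleGraph V, G ≤ H ∧ metricDimension H = n}

/-! Let A, B, C, D be the blocks in code order. D dominates every supergraph H, so distances in H
are 0, 1 or 2, and a set W resolves H iff the vertices outside W have distinct neighbourhoods in W.
So W misses at most one vertex of D, and one may assume that no other outside vertex sees all of W.
Let W have `a`, `b`, `c` vertices in A, B, C. Edges of G join B to all of A ∪ B, so B \ W is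
separated by C ∩ W alone; A is joined to B, so (A ∪ B) \ W is separated by (A ∪ C) ∩ W. Counting
proper subsets gives the inequalities of `IsFeasible`. Conversely, Hall's theorem chooses
neighbourhoods whenever these inequalities hold. Thus τ(G) is t₂ - 1 plus the least `a + b + c` over
feasible triples, and the rest is arithmetic. -/

open Finset

/-! ### Block structure of the code. -/

/-- A labelling of the vertices of `G` by the four blocks of a code `0^{s₁}1^{t₁}0^{s₂}1^{t₂}`. -/
structure IsBlockLabelling {V : Type*} [Fintype V] (G : SimpleGraph V) (s₁ t₁ s₂ t₂ : ℕ)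
    (f : V → Fin 4) : Prop where
  adj : ∀ u v, G.Adj u v ↔ u ≠ v ∧ (max (f u) (f v) = 1 ∨ max (f u) (f v) = 3)
  card_zero : #{v | f v = 0} = s₁
  card_one : #{v | f v = 1} = t₁
  card_two : #{v | f v = 2} = s₂
  card_three : #{v | f v = 3} = t₂

/-- The block of position `j` in the code `0^{s₁}1^{t₁}0^{s₂}1^{t₂}`. -/
def blockIndex (s₁ t₁ s₂ j : ℕ) : Fin 4 :=
  if j < s₁ then 0 else if j < s₁ + t₁ then 1 else if j < s₁ + t₁ + s₂ then 2 else 3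

theorem blockIndex_mono (s₁ t₁ s₂ : ℕ) : Monotone (blockIndex s₁ t₁ s₂) := by
  intro i j h
  unfold blockIndex
  split_ifs <;> omega

theorem twoStringCode_getElem_eq_true_iff {s₁ t₁ s₂ t₂ j : ℕ}
    (h : j < (twoStringCode s₁ t₁ s₂ t₂).length) :
    (twoStringCode s₁ t₁ s₂ t₂)[j] = true ↔
      blockIndex s₁ t₁ s₂ j = 1 ∨ blockIndex s₁ t₁ s₂ j = 3 := by
  unfold blockIndex
  simp only [twoStringCode, List.getElem_append, List.getElem_replicate, List.length_append,
    List.length_replicate]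
  split_ifs <;> first | omega | simp

theorem card_filter_fin_val_eq {n : ℕ} (p : ℕ → Prop) [DecidablePred p] {lo hi : ℕ} (hn : hi ≤ n)
    (hp : ∀ j < n, p j ↔ lo ≤ j ∧ j < hi) : #{j : Fin n | p j} = hi - lo := by
  rw [← Nat.card_Ico]
  refine card_nbij (fun j => j.val) ?_ (fun _ _ _ _ h => Fin.ext h) ?_
  · intro j hj
    simpa [hp j j.2] using hj
  · intro j hj
    have hj' : lo ≤ j ∧ j < hi := by simpa using hj
    exact ⟨⟨j, by omega⟩, by simpa [hp j (by omega)] using hj', rfl⟩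

theorem isBlockLabelling_codeGraph (s₁ t₁ s₂ t₂ : ℕ) :
    IsBlockLabelling (codeGraph (twoStringCode s₁ t₁ s₂ t₂)) s₁ t₁ s₂ t₂
      (fun j => blockIndex s₁ t₁ s₂ j) := by
  have hlen : (twoStringCode s₁ t₁ s₂ t₂).length = s₁ + t₁ + s₂ + t₂ := by
    simp [twoStringCode, add_assoc]
  constructor
  · intro u v
    rw [← (blockIndex_mono s₁ t₁ s₂).map_max]
    simp only [codeGraph, List.get_eq_getElem, twoStringCode_getElem_eq_true_iff]
    have : (max u v).val = max u.val v.val := Fin.coe_max u v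
    rw [this]
  · refine (card_filter_fin_val_eq (blockIndex s₁ t₁ s₂ · = 0) (lo := 0) (hi := s₁)
      (by omega) fun j hj => ?_).trans (by omega)
    unfold blockIndex
    split_ifs <;> simp <;> omega
  · refine (card_filter_fin_val_eq (blockIndex s₁ t₁ s₂ · = 1) (lo := s₁) (hi := s₁ + t₁)
      (by omega) fun j hj => ?_).trans (by omega)
    unfold blockIndex
    split_ifs <;> simp <;> omega
  · refine (card_filter_fin_val_eq (blockIndex s₁ t₁ s₂ · = 2) (lo := s₁ + t₁)
      (hi := s₁ + t₁ + s₂) (by omega) fun j hj => ?_).trans (by omega)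
    unfold blockIndex
    split_ifs <;> simp <;> omega
  · refine (card_filter_fin_val_eq (blockIndex s₁ t₁ s₂ · = 3) (lo := s₁ + t₁ + s₂)
      (hi := s₁ + t₁ + s₂ + t₂) (by omega) fun j hj => ?_).trans (by omega)
    unfold blockIndex
    split_ifs <;> simp <;> omega

theorem IsRealizedBy.exists_isBlockLabelling {V : Type*} [Fintype V] {G : SimpleGraph V}
    {s₁ t₁ s₂ t₂ : ℕ} (hG : IsRealizedBy G (twoStringCode s₁ t₁ s₂ t₂)) :
    ∃ f, IsBlockLabelling G s₁ t₁ s₂ t₂ f := by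
  obtain ⟨e⟩ := hG
  have h := isBlockLabelling_codeGraph s₁ t₁ s₂ t₂
  have hcard (i : Fin 4) : #{v | blockIndex s₁ t₁ s₂ (e v) = i} =
      #{j : Fin (twoStringCode s₁ t₁ s₂ t₂).length | blockIndex s₁ t₁ s₂ j = i} :=
    card_equiv e.toEquiv (by simp)
  exact ⟨fun v => blockIndex s₁ t₁ s₂ (e v),
    fun u v => by rw [← e.map_adj_iff, h.adj, e.injective.ne_iff],
    (hcard 0).trans h.card_zero, (hcard 1).trans h.card_one, (hcard 2).trans h.card_two,
    (hcard 3).trans h.card_three⟩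

/-! ### Distinct representatives and feasible triples. -/

/-- A system of distinct representatives exists when the elements of rank at most `k` are never more
numerous than the common range of the elements of rank `k`. -/
theorem exists_injOn_of_rank {ι α : Type*} [DecidableEq ι] [DecidableEq α] (U : Finset ι)
    (r : ι → ℕ) (F : ℕ → Finset α) (x : α) (h : ∀ k, #{i ∈ U | r i ≤ k} ≤ #(F k)) :
    ∃ φ : ι → α, Set.InjOn φ U ∧ (∀ i ∈ U, φ i ∈ F (r i)) ∧ ∀ i ∉ U, φ i = x := by
  -- Hall's condition for `s` needs only the range of one element of maximal rank in `s`.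
  obtain ⟨ψ, hψ, hmem⟩ := (all_card_le_biUnion_card_iff_exists_injective
      fun i : U => F (r i)).1 fun s => by
    obtain rfl | hs := s.eq_empty_or_nonempty
    · simp
    obtain ⟨i, hi, hmax⟩ := s.exists_max_image (fun i => r i) hs
    calc #s = #(s.map (Function.Embedding.subtype _)) := (card_map _).symm
      _ ≤ #{j ∈ U | r j ≤ r i} := card_le_card fun j hj => by
        obtain ⟨k, hk, rfl⟩ := mem_map.1 hj
        exact mem_filter.2 ⟨k.2, hmax k hk⟩
      _ ≤ #(F (r i)) := h _
      _ ≤ _ := card_le_card (subset_biUnion_of_mem (fun i : U => F (r i)) hi)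
  refine ⟨fun i => if hi : i ∈ U then ψ ⟨i, hi⟩ else x, fun i hi j hj hij => ?_,
    fun i hi => ?_, fun i hi => dif_neg hi⟩
  · rw [mem_coe] at hi hj
    simp only [dif_pos hi, dif_pos hj] at hij
    exact congrArg Subtype.val (hψ hij)
  · simp only [dif_pos hi]
    exact hmem ⟨i, hi⟩

/-- The numerical conditions for a set with `a`, `b`, `c` elements in the first three blocks to
separate, in some supergraph, the other vertices of these blocks from each other and from a
dominating vertex. -/
structure IsFeasible (s₁ t₁ s₂ a b c : ℕ) : Prop where
  le_zero : a ≤ s₁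
  le_one : b ≤ t₁
  le_two : c ≤ s₂
  one : t₁ + 1 ≤ 2 ^ c + b
  zero_one : s₁ + t₁ + 1 ≤ 2 ^ (a + c) + a + b
  total : s₁ + t₁ + s₂ + 1 ≤ 2 ^ (a + b + c) + a + b + c

/-! ### Resolving sets in the presence of dominating vertices. -/

theorem metricDimension_le_card {V : Type*} {H : SimpleGraph V} {W : Finset V}
    (hW : IsResolvingSet H W) :
    metricDimension H ≤ #W :=
  Nat.sInf_le ⟨W, hW, rfl⟩

theorem exists_isResolvingSet_card_eq {V : Type*} [Fintype V] (H : SimpleGraph V) :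
    ∃ W, IsResolvingSet H W ∧ #W = metricDimension H :=
  Nat.sInf_mem (s := {n : ℕ | ∃ W : Finset V, IsResolvingSet H W ∧ W.card = n})
    ⟨_, univ, isResolvingSet_univ H, rfl⟩

theorem thresholdDimension_le_card {V : Type*} {G H : SimpleGraph V} {W : Finset V} (hGH : G ≤ H)
    (hW : IsResolvingSet H W) : thresholdDimension G ≤ #W :=
  le_trans (Nat.sInf_le ⟨H, hGH, rfl⟩) (metricDimension_le_card hW)

theorem exists_isResolvingSet_card_eq_thresholdDimension {V : Type*} [Fintype V]
    (G : SimpleGraph V) :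
    ∃ H, G ≤ H ∧ ∃ W, IsResolvingSet H W ∧ #W = thresholdDimension G := by
  obtain ⟨H, hGH, hH⟩ := Nat.sInf_mem
    (s := {n : ℕ | ∃ H : SimpleGraph V, G ≤ H ∧ metricDimension H = n}) ⟨_, G, le_rfl, rfl⟩
  obtain ⟨W, hW, hcard⟩ := exists_isResolvingSet_card_eq H
  exact ⟨H, hGH, W, hW, hcard.trans hH⟩

/-- In a graph with a dominating vertex, distances between distinct vertices are determined by
adjacency. -/
theorem edist_eq_edist_of_dominating {V : Type*} {H : SimpleGraph V} {d u v w : V}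
    (hd : ∀ x, x ≠ d → H.Adj d x) (hu : u ≠ w) (hv : v ≠ w) (h : H.Adj u w ↔ H.Adj v w) :
    H.edist u w = H.edist v w := by
  have key : ∀ x, x ≠ w → ¬ H.Adj x w → H.edist x w = 2 := by
    intro x hx hxw
    have hxd : x ≠ d := by rintro rfl; exact hxw (hd w hx.symm)
    have hwd : w ≠ d := by rintro rfl; exact hxw (hd x hx).symm
    have hle : H.edist x w ≤ 2 := by
      calc H.edist x w ≤ H.edist x d + H.edist d w := SimpleGraph.edist_triangle
        _ = 1 + 1 := by
          rw [SimpleGraph.edist_eq_one_iff_adj.2 (hd x hxd).symm,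
            SimpleGraph.edist_eq_one_iff_adj.2 (hd w hwd)]
        _ = 2 := one_add_one_eq_two
    refine le_antisymm hle ?_
    by_contra! hlt
    have h0 : H.edist x w ≠ 0 := fun h0 => hx (SimpleGraph.edist_eq_zero_iff.1 h0)
    have h1 : H.edist x w ≠ 1 := fun h1 => hxw (SimpleGraph.edist_eq_one_iff_adj.1 h1)
    generalize H.edist x w = e at *
    lift e to ℕ using ne_top_of_lt hlt
    norm_cast at *
    omega
  by_cases huw : H.Adj u w
  · rw [SimpleGraph.edist_eq_one_iff_adj.2 huw, SimpleGraph.edist_eq_one_iff_adj.2 (h.1 huw)]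
  · rw [key u hu huw, key v hv (mt h.2 huw)]

section

variable {V : Type*} [Fintype V] [DecidableEq V]

/-- The vertices of `U` outside `W` have distinct neighbourhoods in `W`, none of them all
of `W`. -/
def Separates {V : Type*} (H : SimpleGraph V) (U W : Finset V) : Prop :=
  ∀ u ∈ U, u ∉ W → (∃ w ∈ W, ¬ H.Adj u w) ∧
    ∀ v ∈ U, v ∉ W → (∀ w ∈ W, H.Adj u w ↔ H.Adj v w) → u = v

/-- Dominating vertices separate no two outside vertices, and two of them outside `W` would look
alike, so at least `#D - 1` of the elements of `W` lie in `D` and serve only themselves. -/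
theorem exists_separates_of_isResolvingSet {H : SimpleGraph V} {D W : Finset V}
    (hD : D.Nonempty) (hdom : ∀ d ∈ D, ∀ x, x ≠ d → H.Adj d x) (hW : IsResolvingSet H W) :
    ∃ W' ⊆ Dᶜ, #W' + (#D - 1) ≤ #W ∧ Separates H Dᶜ W' := by
  obtain ⟨d₀, hd₀⟩ := hD
  have hinj : ∀ u, u ∉ W → ∀ v, v ∉ W → (∀ w ∈ W, H.Adj u w ↔ H.Adj v w) → u = v :=
    fun u hu v hv h => hW u v fun w hw => edist_eq_edist_of_dominating (hdom d₀ hd₀)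
      (fun e => hu (e ▸ hw)) (fun e => hv (e ▸ hw)) (h w hw)
  have hinj' : ∀ u ∈ Dᶜ, u ∉ W → ∀ v ∈ Dᶜ, v ∉ W → (∀ w ∈ W \ D, H.Adj u w ↔ H.Adj v w) →
      u = v := by
    intro u hu huW v hv hvW h
    refine hinj u huW v hvW fun w hw => ?_
    by_cases hwD : w ∈ D
    · have h1 := hdom w hwD u (fun e => huW (e ▸ hw))
      have h2 := hdom w hwD v (fun e => hvW (e ▸ hw))
      exact ⟨fun _ => h2.symm, fun _ => h1.symm⟩
    · exact h w (mem_sdiff.2 ⟨hw, hwD⟩)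
  have hmem : ∀ u ∈ Dᶜ, u ∉ W \ D → u ∉ W := fun u hu h hw =>
    h (mem_sdiff.2 ⟨hw, mem_compl.1 hu⟩)
  have hsub : W \ D ⊆ Dᶜ := fun w hw => mem_compl.2 (mem_sdiff.1 hw).2
  have hcW : #(W \ D) + #(W ∩ D) = #W := card_sdiff_add_card_inter W D
  have hcD : #(D \ W) + #(W ∩ D) = #D := by
    rw [inter_comm]; exact card_sdiff_add_card_inter D W
  have hone : #(D \ W) ≤ 1 := by
    refine card_le_one.2 fun u hu v hv => ?_
    rw [mem_sdiff] at hu hv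
    exact hinj u hu.2 v hv.2 fun w hw => by
      have h1 := hdom u hu.1 w (fun e => hu.2 (e ▸ hw))
      have h2 := hdom v hv.1 w (fun e => hv.2 (e ▸ hw))
      exact ⟨fun _ => h2, fun _ => h1⟩
  -- Such an `x` looks like a dominating vertex outside `W`, so `D ⊆ W`. Trading one vertex of `D`
  -- for `x` keeps the count and removes the full neighbourhood.
  by_cases hx : ∃ x ∈ Dᶜ, x ∉ W ∧ ∀ w ∈ W \ D, H.Adj x w
  · obtain ⟨x, hxD, hxW, hxadj⟩ := hx
    have hDW : #(D \ W) = 0 := by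
      rw [card_eq_zero, eq_empty_iff_forall_notMem]
      intro d hd
      rw [mem_sdiff] at hd
      have : d = x := by
        refine hinj d hd.2 x hxW fun w hw => ?_
        have h1 := hdom d hd.1 w (fun e => hd.2 (e ▸ hw))
        refine ⟨fun _ => ?_, fun _ => h1⟩
        by_cases hwD : w ∈ D
        · exact (hdom w hwD x (fun e => hxW (e ▸ hw))).symm
        · exact hxadj w (mem_sdiff.2 ⟨hw, hwD⟩)
      exact mem_compl.1 hxD (this ▸ hd.1)
    refine ⟨insert x (W \ D), insert_subset hxD hsub, ?_, fun u hu huW => ⟨?_, ?_⟩⟩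
    · have := card_insert_le x (W \ D)
      have : 0 < #D := card_pos.2 ⟨d₀, hd₀⟩
      omega
    · rw [mem_insert, not_or] at huW
      by_contra! hall
      exact huW.1 (hinj' u hu (hmem u hu huW.2) x hxD hxW fun w hw =>
        ⟨fun _ => hxadj w hw, fun _ => hall w (mem_insert_of_mem hw)⟩)
    · intro v hv hvW h
      rw [mem_insert, not_or] at huW hvW
      exact hinj' u hu (hmem u hu huW.2) v hv (hmem v hv hvW.2) fun w hw =>
        h w (mem_insert_of_mem hw)
  · push Not at hx
    refine ⟨W \ D, hsub, by omega, fun u hu huW => ⟨hx u hu (hmem u hu huW), ?_⟩⟩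
    exact fun v hv hvW h => hinj' u hu (hmem u hu huW) v hv (hmem v hv hvW) h

/-- If the vertices of `S` are joined to all of `W` outside `T`, then they are separated by `T`. -/
theorem Separates.card_lt {V : Type*} [DecidableEq V] {H : SimpleGraph V} {U W S T : Finset V}
    (h : Separates H U W)
    (hSU : S ⊆ U) (hSW : Disjoint S W)
    (hadj : ∀ v ∈ S, ∀ w ∈ W, w ∉ T → H.Adj v w) : #S < 2 ^ #T := by
  classical
  -- The full set `T` is erased: attaining it would mean adjacency to all of `W`.
  rw [← card_powerset, ← card_erase_add_one (mem_powerset_self T), Nat.lt_succ_iff]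
  have hS : ∀ v ∈ S, v ∉ W := fun v hv => disjoint_left.1 hSW hv
  refine card_le_card_of_injOn (fun v => T.filter (H.Adj v)) (fun v hv => ?_)
    fun u hu v hv huv => ?_
  · obtain ⟨w, hw, hvw⟩ := (h v (hSU hv) (hS v hv)).1
    refine mem_erase.2 ⟨fun he => ?_, mem_powerset.2 (filter_subset _ _)⟩
    have hwT : w ∈ T := by
      by_contra hwT
      exact hvw (hadj v hv w hw hwT)
    exact hvw (filter_eq_self.1 he w hwT)
  · refine (h u (hSU hu) (hS u hu)).2 v (hSU hv) (hS v hv) fun w hw => ?_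
    by_cases hwT : w ∈ T
    · have := congrArg (w ∈ ·) huv
      simpa [hwT] using this
    · exact ⟨fun _ => hadj v hv w hw hwT, fun _ => hadj u hu w hw hwT⟩

/-! ### Lower bound: a resolving set yields a feasible triple. -/

theorem IsBlockLabelling.exists_isFeasible {G : SimpleGraph V} {s₁ t₁ s₂ t₂ : ℕ} {f : V → Fin 4}
    (hf : IsBlockLabelling G s₁ t₁ s₂ t₂ f) (ht₂ : 0 < t₂) :
    ∃ a b c, IsFeasible s₁ t₁ s₂ a b c ∧ a + b + c + (t₂ - 1) ≤ thresholdDimension G := by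
  obtain ⟨H, hGH, W₀, hW₀, hcard⟩ := exists_isResolvingSet_card_eq_thresholdDimension G
  have hdom : ∀ d ∈ ({v | f v = 3} : Finset V), ∀ x, x ≠ d → H.Adj d x := by
    intro d hd x hx
    refine hGH ((hf.adj d x).2 ⟨hx.symm, Or.inr ?_⟩)
    rw [(mem_filter.1 hd).2]
    generalize f x = i
    revert i; decide
  obtain ⟨W, hWD, hle, hsep⟩ := exists_separates_of_isResolvingSet
    (card_pos.1 (hf.card_three ▸ ht₂)) hdom hW₀
  rw [hf.card_three, hcard] at hle
  have hW3 : ∀ w ∈ W, f w ≠ 3 := fun w hw => by simpa using hWD hw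
  set A : Finset V := {v | f v = 0} with hA
  set B : Finset V := {v | f v = 1} with hB
  set C : Finset V := {v | f v = 2} with hC
  have hAB : Disjoint A B := disjoint_filter.2 fun v _ h0 h1 => by simp [h0] at h1
  have hAC : Disjoint A C := disjoint_filter.2 fun v _ h0 h1 => by simp [h0] at h1
  have hBC : Disjoint B C := disjoint_filter.2 fun v _ h0 h1 => by simp [h0] at h1
  have hWu : W = (A ∩ W ∪ B ∩ W) ∪ C ∩ W := by
    ext w
    simp only [hA, hB, hC, mem_union, mem_inter, mem_filter, mem_univ, true_and]
    by_cases hw : w ∈ W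
    · simp only [hw, and_true, true_iff]
      have := hW3 w hw
      generalize f w = i at this
      revert i; decide
    · simp [hw]
  have hcW : #W = #(A ∩ W) + #(B ∩ W) + #(C ∩ W) := by
    conv_lhs => rw [hWu]
    rw [card_union_of_disjoint, card_union_of_disjoint]
    · exact hAB.mono inter_subset_left inter_subset_left
    · exact disjoint_union_left.2 ⟨hAC.mono inter_subset_left inter_subset_left,
        hBC.mono inter_subset_left inter_subset_left⟩
  have hcAC : #((A ∪ C) ∩ W) = #(A ∩ W) + #(C ∩ W) := by
    rw [union_inter_distrib_right, card_union_of_disjoint]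
    exact hAC.mono inter_subset_left inter_subset_left
  have hcA : #(A \ W) + #(A ∩ W) = s₁ := (card_sdiff_add_card_inter A W).trans hf.card_zero
  have hcB : #(B \ W) + #(B ∩ W) = t₁ := (card_sdiff_add_card_inter B W).trans hf.card_one
  have hcC : #(C \ W) + #(C ∩ W) = s₂ := (card_sdiff_add_card_inter C W).trans hf.card_two
  have hcAB : #((A ∪ B) \ W) = #(A \ W) + #(B \ W) := by
    rw [union_sdiff_distrib, card_union_of_disjoint]
    exact hAB.mono sdiff_subset sdiff_subset
  have hcABC : #((A ∪ B ∪ C) \ W) = #(A \ W) + #(B \ W) + #(C \ W) := by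
    rw [union_sdiff_distrib, card_union_of_disjoint, hcAB]
    exact (disjoint_union_left.2 ⟨hAC, hBC⟩).mono sdiff_subset sdiff_subset
  have h1 : #(B \ W) < 2 ^ #(C ∩ W) := by
    refine hsep.card_lt ?_ sdiff_disjoint ?_
    · intro v hv
      simp only [hB, mem_sdiff, mem_filter, mem_univ, true_and] at hv
      simp [hv.1]
    · intro v hv w hw hwT
      have h3 := hW3 w hw
      rw [mem_sdiff] at hv
      refine hGH ((hf.adj v w).2 ⟨fun e => hv.2 (e ▸ hw), ?_⟩)
      simp only [hB, hC, mem_inter, mem_filter, mem_univ, true_and, hw, and_true] at hv hwT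
      rw [hv.1]
      generalize f w = i at *
      revert i; decide
  have h2 : #((A ∪ B) \ W) < 2 ^ #((A ∪ C) ∩ W) := by
    refine hsep.card_lt ?_ sdiff_disjoint ?_
    · intro v hv
      simp only [hA, hB, mem_sdiff, mem_union, mem_filter, mem_univ, true_and] at hv
      obtain ⟨h | h, -⟩ := hv <;> simp [h]
    · intro v hv w hw hwT
      have h3 := hW3 w hw
      rw [mem_sdiff] at hv
      refine hGH ((hf.adj v w).2 ⟨fun e => hv.2 (e ▸ hw), ?_⟩)
      simp only [hA, hB, hC, mem_inter, mem_union, mem_filter, mem_univ, true_and, hw,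
        and_true] at hv hwT
      replace hv := hv.1
      generalize f w = i at h3 hwT ⊢
      generalize f v = j at hv ⊢
      revert i j; decide
  have h3 : #((A ∪ B ∪ C) \ W) < 2 ^ #W := by
    refine hsep.card_lt ?_ sdiff_disjoint fun v _ w hw hwT => absurd hw hwT
    intro v hv
    simp only [hA, hB, hC, mem_sdiff, mem_union, mem_filter, mem_univ, true_and] at hv
    obtain ⟨(h | h) | h, -⟩ := hv <;> simp [h]
  rw [hcAB, hcAC] at h2
  rw [hcABC, hcW] at h3
  exact ⟨#(A ∩ W), #(B ∩ W), #(C ∩ W),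
    ⟨by omega, by omega, by omega, by omega, by omega, by omega⟩, by omega⟩

/-! ### Upper bound: a feasible triple yields a supergraph. -/

/-- A set becomes resolving, together with the vertices of `D`, after new edges realize prescribed
distinct proper neighbourhoods `φ v` for all but one of the remaining vertices. -/
theorem thresholdDimension_le_of_neighbourhoods {V : Type*} [DecidableEq V] {G : SimpleGraph V}
    {U W D : Finset V} {d : V} (φ : V → Finset V) (hcover : ∀ v, v ∈ U ∨ v ∈ W ∨ v ∈ D ∨ v = d)
    (hUW : Disjoint U W) (hd : ∀ w ∈ W, G.Adj d w) (hφW : ∀ v ∈ U, φ v ⊂ W)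
    (hφ : ∀ v ∉ U, φ v = ∅) (hinj : Set.InjOn φ U) (hG : ∀ v ∈ U, ∀ w ∈ W, G.Adj v w → w ∈ φ v) :
    thresholdDimension G ≤ #W + #D := by
  -- `fromRel` symmetrizes, but `φ` is empty on `W`, so between `U` and `W` only the prescribed
  -- edges are added.
  set H : SimpleGraph V := G ⊔ SimpleGraph.fromRel fun u v => v ∈ φ u with hH
  have hUadj : ∀ v ∈ U, ∀ w ∈ W, H.Adj v w ↔ w ∈ φ v := by
    intro v hv w hw
    have hne : v ≠ w := fun e => disjoint_left.1 hUW hv (e ▸ hw)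
    have hw' : φ w = ∅ := hφ w (disjoint_right.1 hUW hw)
    simp only [hH, SimpleGraph.sup_adj, SimpleGraph.fromRel_adj, hw', notMem_empty, or_false]
    exact ⟨fun h => h.elim (hG v hv w hw) And.right, fun h => Or.inr ⟨hne, h⟩⟩
  have hdadj : ∀ w ∈ W, H.Adj d w := fun w hw => Or.inl (hd w hw)
  refine (thresholdDimension_le_card (H := H) (W := W ∪ D) le_sup_left ?_).trans
    (card_union_le W D)
  intro u v huv
  have hadj : ∀ w ∈ W, H.Adj u w ↔ H.Adj v w := fun w hw => by
    rw [← SimpleGraph.edist_eq_one_iff_adj, ← SimpleGraph.edist_eq_one_iff_adj,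
      huv w (mem_union_left D hw)]
  by_cases hu : u ∈ W ∪ D
  · have := huv u hu
    rw [SimpleGraph.edist_self] at this
    exact (SimpleGraph.edist_eq_zero_iff.1 this.symm).symm
  by_cases hv : v ∈ W ∪ D
  · have := huv v hv
    rw [SimpleGraph.edist_self] at this
    exact SimpleGraph.edist_eq_zero_iff.1 this
  have hcover' : ∀ x ∉ W ∪ D, x ∈ U ∨ x = d := fun x hx => by
    rw [mem_union, not_or] at hx
    simpa [hx.1, hx.2] using hcover x
  have hproper : ∀ x ∈ U, ¬ ∀ w ∈ W, H.Adj x w ↔ H.Adj d w := fun x hx h =>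
    (hφW x hx).2 fun w hw => (hUadj x hx w hw).1 ((h w hw).2 (hdadj w hw))
  obtain hu | rfl := hcover' u hu <;> obtain hv | rfl := hcover' v hv
  · refine hinj hu hv (ext fun w => ?_)
    by_cases hw : w ∈ W
    · rw [← hUadj u hu w hw, hadj w hw, hUadj v hv w hw]
    · exact iff_of_false (fun h => hw ((hφW u hu).1 h)) fun h => hw ((hφW v hv).1 h)
  · exact absurd hadj (hproper u hu)
  · exact absurd (fun w hw => (hadj w hw).symm) (hproper v hv)
  · rfl

theorem card_Icc_erase_right {V : Type*} [DecidableEq V] {R W : Finset V} (h : R ⊆ W) :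
    #((Icc R W).erase W) = 2 ^ (#W - #R) - 1 := by
  rw [card_erase_of_mem (right_mem_Icc.2 h), card_Icc_finset h]

theorem IsBlockLabelling.thresholdDimension_le {G : SimpleGraph V} {s₁ t₁ s₂ t₂ : ℕ}
    {f : V → Fin 4} (hf : IsBlockLabelling G s₁ t₁ s₂ t₂ f) (ht₂ : 0 < t₂) {a b c : ℕ}
    (h : IsFeasible s₁ t₁ s₂ a b c) : thresholdDimension G ≤ a + b + c + (t₂ - 1) := by
  obtain ⟨hs₁, ht₁, hs₂, h1, h2, h3⟩ := h
  obtain ⟨A, hA, rfl⟩ := exists_subset_card_eq (hs₁.trans_eq hf.card_zero.symm)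
  obtain ⟨B, hB, rfl⟩ := exists_subset_card_eq (ht₁.trans_eq hf.card_one.symm)
  obtain ⟨C, hC, rfl⟩ := exists_subset_card_eq (hs₂.trans_eq hf.card_two.symm)
  obtain ⟨d, hd⟩ := card_pos.1 (hf.card_three ▸ ht₂)
  have hA' : ∀ v ∈ A, f v = 0 := fun v hv => by simpa using hA hv
  have hB' : ∀ v ∈ B, f v = 1 := fun v hv => by simpa using hB hv
  have hC' : ∀ v ∈ C, f v = 2 := fun v hv => by simpa using hC hv
  have hd' : f d = 3 := by simpa using hd
  have hAB : Disjoint A B := disjoint_left.2 fun v ha hb => by simpa [hA' v ha] using hB' v hb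
  have hABC : Disjoint (A ∪ B) C := by grind [disjoint_left]
  set W := A ∪ B ∪ C with hW
  have hcAB : #(A ∪ B) = #A + #B := card_union_of_disjoint hAB
  have hcW : #W = #A + #B + #C := by rw [hW, card_union_of_disjoint hABC, hcAB]
  set U : Finset V := {v | v ∉ W ∧ f v ≠ 3} with hU
  -- Ranks order the blocks B, A, C by decreasing constraint; `R k` is the part of `W` to which G
  -- already joins the vertices of rank `k`.
  set r : V → ℕ := fun v => if f v = 1 then 0 else if f v = 0 then 1 else 2 with hr
  set R : ℕ → Finset V := fun k => if k = 0 then A ∪ B else if k = 1 then B else ∅ with hR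
  have hcA : #(({v | f v = 0} : Finset V) \ A) = s₁ - #A := by
    rw [card_sdiff_of_subset hA, hf.card_zero]
  have hcB : #(({v | f v = 1} : Finset V) \ B) = t₁ - #B := by
    rw [card_sdiff_of_subset hB, hf.card_one]
  have hcC : #(({v | f v = 2} : Finset V) \ C) = s₂ - #C := by
    rw [card_sdiff_of_subset hC, hf.card_two]
  obtain ⟨φ, hinj, hmem, hφ⟩ := exists_injOn_of_rank U r (fun k => (Icc (R k) W).erase W) ∅ <| by
    intro k
    have hRW : R k ⊆ W := by grind
    rw [card_Icc_erase_right hRW, hcW]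
    obtain hk | hk | hk : k = 0 ∨ k = 1 ∨ 2 ≤ k := by omega
    · have hle : #{v ∈ U | r v ≤ k} ≤ t₁ - #B := by
        rw [← hcB]
        exact card_le_card fun v hv => by grind
      have : #A + #B + #C - #(R k) = #C := by simp [hR, hk, hcAB]
      rw [this]
      omega
    · have hle : #{v ∈ U | r v ≤ k} ≤ (s₁ - #A) + (t₁ - #B) := by
        rw [← hcA, ← hcB]
        exact (card_le_card fun v hv => by grind).trans (card_union_le _ _)
      have : #A + #B + #C - #(R k) = #A + #C := by simp [hR, hk]; omega
      rw [this]
      omega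
    · have hle : #{v ∈ U | r v ≤ k} ≤ (s₁ - #A) + (t₁ - #B) + (s₂ - #C) := by
        rw [← hcA, ← hcB, ← hcC]
        refine (card_le_card fun v hv => ?_).trans
          ((card_union_le _ _).trans (Nat.add_le_add_right (card_union_le _ _) _))
        have : f v = 0 ∨ f v = 1 ∨ f v = 2 ∨ f v = 3 := by
          generalize f v = i
          revert i; decide
        grind
      have : #A + #B + #C - #(R k) = #A + #B + #C := by
        simp [hR, show k ≠ 0 by omega, show k ≠ 1 by omega]
      rw [this]
      omega
  have hUW : Disjoint U W := disjoint_left.2 fun v hv => (mem_filter.1 hv).2.1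
  have hcard : #(({v | f v = 3} : Finset V).erase d) = t₂ - 1 := by
    rw [card_erase_of_mem hd, hf.card_three]
  rw [← hcW, ← hcard]
  refine thresholdDimension_le_of_neighbourhoods φ (d := d) ?_ hUW ?_ ?_ hφ hinj ?_
  · grind
  · intro w hw
    have hw3 : f w ≠ 3 := by grind
    refine (hf.adj d w).2 ⟨fun e => hw3 (e ▸ hd'), Or.inr ?_⟩
    rw [hd']
    generalize f w = i
    revert i; decide
  · intro v hv
    obtain ⟨h1, h2⟩ := mem_erase.1 (hmem v hv)
    exact (mem_Icc.1 h2).2.lt_of_ne h1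
  · intro v hv w hw hvw
    refine (mem_Icc.1 (mem_erase.1 (hmem v hv)).2).1 ?_
    have hv3 : f v ≠ 3 := (mem_filter.1 hv).2.2
    have hw3 : f w ≠ 3 := by grind
    have hfw := ((hf.adj v w).1 hvw).2
    have hkey : (f v = 1 ∧ (f w = 0 ∨ f w = 1)) ∨ (f v = 0 ∧ f w = 1) := by
      generalize f w = i at hfw hw3 ⊢
      generalize f v = j at hfw hv3 ⊢
      revert i j; decide
    grind

end

/-! ### Minimizing over feasible triples. -/

theorem exists_isLeast_of_sub_le {N : ℤ} {p : ℕ → ℤ} (h : ∃ k : ℕ, 0 < k ∧ N - k ≤ p k) :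
    ∃ k₀ : ℕ, IsLeast {k : ℕ | 0 < k ∧ N - k ≤ p k} k₀ := by
  classical
  exact ⟨Nat.find h, Nat.find_spec h, fun k hk => Nat.find_min' h hk⟩

theorem int_le_two_pow_sub_one_iff {m k : ℕ} : (m : ℤ) ≤ 2 ^ k - 1 ↔ m + 1 ≤ 2 ^ k := by
  zify
  omega

/-- A value attained by a feasible triple and bounding all of them gives the threshold dimension. -/
theorem IsBlockLabelling.thresholdDimension_eq {V : Type*} [Fintype V] {G : SimpleGraph V}
    {s₁ t₁ s₂ t₂ : ℕ} {f : V → Fin 4} (hf : IsBlockLabelling G s₁ t₁ s₂ t₂ f) (ht₂ : 0 < t₂)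
    {a b c : ℕ} (h : IsFeasible s₁ t₁ s₂ a b c)
    (hmin : ∀ a' b' c', IsFeasible s₁ t₁ s₂ a' b' c' → a + b + c ≤ a' + b' + c') :
    (thresholdDimension G : ℤ) = ((t₂ : ℤ) - 1) + (a + b + c) := by
  classical
  have h1 := hf.thresholdDimension_le ht₂ h
  obtain ⟨a', b', c', h', h2⟩ := hf.exists_isFeasible ht₂
  have h3 := hmin a' b' c' h'
  omega

theorem IsFeasible.pos {s₁ t₁ s₂ a b c : ℕ} (hs₂ : 0 < s₂) (h : IsFeasible s₁ t₁ s₂ a b c) :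
    0 < a + b + c := by
  by_contra! h0
  obtain ⟨rfl, rfl, rfl⟩ : a = 0 ∧ b = 0 ∧ c = 0 := by omega
  have := h.total
  simp only [Nat.add_zero, pow_zero] at this
  omega

/-- The count of all the vertices of the first three blocks is the only constraint when the second
block is small. -/
theorem exists_isFeasible_of_isLeast {s₁ t₁ s₂ k : ℕ}
    (hk : IsLeast {k : ℕ | 0 < k ∧ s₁ + t₁ + s₂ + 1 ≤ 2 ^ k + k} k)
    (h : k ≤ s₂ ∨ t₁ + 1 ≤ 2 ^ s₂) (hs₂ : 0 < s₂) :
    ∃ a c, IsFeasible s₁ t₁ s₂ a 0 c ∧ a + c = k := by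
  have hk1 : s₁ + t₁ + s₂ + 1 ≤ 2 ^ k + k := hk.1.2
  by_cases hks : k ≤ s₂
  · exact ⟨0, k, ⟨by omega, by omega, hks, by omega, by simp; omega, by simp; omega⟩, by omega⟩
  · have ht : t₁ + 1 ≤ 2 ^ s₂ := h.resolve_left hks
    -- Minimality against the candidate `s₁ + s₂` shows that the first block can supply the `k - s₂`
    -- vertices beyond C.
    have hle : k ≤ s₁ + s₂ := hk.2 ⟨by omega, by
      have : 2 ^ s₂ ≤ 2 ^ (s₁ + s₂) := Nat.pow_le_pow_right (by omega) (by omega)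
      omega⟩
    have hk2 : k - s₂ + s₂ = k := by omega
    refine ⟨k - s₂, s₂, ⟨by omega, by omega, le_rfl, by omega, ?_, ?_⟩, hk2⟩
    · rw [hk2]; omega
    · simp only [Nat.add_zero, hk2]
      omega

/-- The optimal triple when the second block is large. -/
theorem isFeasible_of_isLeast {s₁ t₁ s₂ k : ℕ} (ht : 2 ^ s₂ ≤ t₁ + 1) (hs₁ : 0 < s₁)
    (hk : IsLeast {k : ℕ | 0 < k ∧ s₁ + 2 ^ s₂ ≤ 2 ^ (s₂ + k) + k} k) :
    IsFeasible s₁ t₁ s₂ k (t₁ + 1 - 2 ^ s₂) s₂ := by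
  have h1 := hk.1.2
  have hpos : 0 < 2 ^ s₂ := by positivity
  have hle : k ≤ s₁ := hk.2 ⟨hs₁, by
    have : 2 ^ s₂ ≤ 2 ^ (s₂ + s₁) := Nat.pow_le_pow_right (by omega) (by omega)
    omega⟩
  have h2 : 2 ^ (k + s₂) ≤ 2 ^ (k + (t₁ + 1 - 2 ^ s₂) + s₂) :=
    Nat.pow_le_pow_right (by omega) (by omega)
  rw [add_comm k s₂] at h2
  refine ⟨hle, by omega, le_rfl, by omega, ?_, by omega⟩
  rw [add_comm k s₂]
  omega

/-- The lower bound for feasible triples when the second block is large. -/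
theorem IsFeasible.le_of_isLeast {s₁ t₁ s₂ a b c k : ℕ} (ht : 2 ^ s₂ ≤ t₁ + 1) (hs₁ : 0 < s₁)
    (hk : IsLeast {k : ℕ | 0 < k ∧ s₁ + 2 ^ s₂ ≤ 2 ^ (s₂ + k) + k} k)
    (h : IsFeasible s₁ t₁ s₂ a b c) : k + (t₁ + 1 - 2 ^ s₂) + s₂ ≤ a + b + c := by
  have hc := h.le_two
  have h1 := h.one
  have h2 := h.zero_one
  have hcs : 2 ^ c ≤ 2 ^ s₂ := Nat.pow_le_pow_right (by omega) hc
  -- The slack `j` counts vertices of B beyond those forced by `c`; `a + j` will compete with `k`.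
  obtain ⟨j, hj⟩ := Nat.exists_eq_add_of_le h1
  -- Using fewer vertices of C never pays: each one dropped forces at least one more from B.
  have hgap : 2 ^ c + s₂ ≤ 2 ^ s₂ + c := by
    obtain ⟨e, rfl⟩ := Nat.exists_eq_add_of_le hc
    have he : e + 1 ≤ 2 ^ e := Nat.lt_two_pow_self
    have hc1 : 1 ≤ 2 ^ c := Nat.one_le_two_pow
    rw [pow_add]
    nlinarith
  have hkey : s₁ + 2 ^ s₂ ≤ 2 ^ (s₂ + (a + j)) + (a + j) := by
    have e1 : 2 ^ (a + c) ≤ 2 ^ c * 2 ^ (a + j) := by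
      rw [← pow_add]
      exact Nat.pow_le_pow_right (by omega) (by omega)
    have e2 : 1 ≤ 2 ^ (a + j) := Nat.one_le_two_pow
    rw [pow_add 2 s₂]
    nlinarith
  have hpos : 0 < a + j := by
    by_contra! h0
    have h0 : a + j = 0 := by omega
    rw [h0] at hkey
    simp at hkey
    omega
  have := hk.2 ⟨hpos, hkey⟩
  omega

/-! ### The three cases. -/

theorem mainTheorem6 {V : Type*} [Fintype V] (G : SimpleGraph V) (s₁ t₁ s₂ t₂ : ℕ)
    (hs₁ : 0 < s₁) (ht₁ : 0 < t₁) (hs₂ : 0 < s₂) (ht₂ : 0 < t₂)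
    (hG : IsRealizedBy G (twoStringCode s₁ t₁ s₂ t₂))
    (m₁ m₂ : ℤ) (hm₁ : m₁ = (t₁ : ℤ) - 2 ^ s₂ + 1) (hm₂ : m₂ = 2 ^ s₂ - 1 - (t₁ : ℤ)) :
    -- case (i)
    (∀ k₁ : ℕ,
      IsLeast {k : ℕ | 0 < k ∧ (s₁ : ℤ) + t₁ + s₂ - k ≤ 2 ^ k - 1} k₁ →
      (k₁ ≤ s₂ ∨ (t₁ : ℤ) ≤ 2 ^ s₂ - 1) →
      (thresholdDimension G : ℤ) = ((t₂ : ℤ) - 1) + k₁) ∧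
    -- case (ii)
    (∀ k₂ : ℕ,
      (t₁ : ℤ) ≥ 2 ^ s₂ - 1 →
      IsLeast {k : ℕ | 0 < k ∧ (s₁ : ℤ) - k ≤ 2 ^ (s₂ + k) - 2 ^ s₂} k₂ →
      (thresholdDimension G : ℤ) = ((t₂ : ℤ) - 1) + s₂ + m₁ + k₂) ∧
    -- case (iii)
    (∀ k₂ : ℕ,
      (t₁ : ℤ) < 2 ^ s₂ - 1 → m₂ < (s₁ : ℤ) →
      IsLeast {k : ℕ | 0 < k ∧ (s₁ : ℤ) - m₂ - k ≤ 2 ^ (s₂ + k) - 2 ^ s₂} k₂ →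
      (thresholdDimension G : ℤ) = ((t₂ : ℤ) - 1) + s₂ + k₂) ∧
    -- one of the three cases always applies
    ((∃ k₁ : ℕ, k₁ ≤ s₂ ∧
        IsLeast {k : ℕ | 0 < k ∧ (s₁ : ℤ) + t₁ + s₂ - k ≤ 2 ^ k - 1} k₁) ∨
      ((t₁ : ℤ) ≥ 2 ^ s₂ - 1 ∧
        ∃ k₂ : ℕ, IsLeast {k : ℕ | 0 < k ∧ (s₁ : ℤ) - k ≤ 2 ^ (s₂ + k) - 2 ^ s₂} k₂) ∨
      ((t₁ : ℤ) < 2 ^ s₂ - 1 ∧ m₂ < (s₁ : ℤ) ∧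
        ∃ k₂ : ℕ,
          IsLeast {k : ℕ | 0 < k ∧ (s₁ : ℤ) - m₂ - k ≤ 2 ^ (s₂ + k) - 2 ^ s₂} k₂)) := by
  obtain ⟨f, hf⟩ := hG.exists_isBlockLabelling
  have set_one : {k : ℕ | 0 < k ∧ (s₁ : ℤ) + t₁ + s₂ - k ≤ 2 ^ k - 1} =
      {k : ℕ | 0 < k ∧ s₁ + t₁ + s₂ + 1 ≤ 2 ^ k + k} := by
    ext k
    simp only [Set.mem_ofPred_eq]
    zify
    exact and_congr_right fun _ => ⟨fun h => by linarith, fun h => by linarith⟩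
  have set_two : {k : ℕ | 0 < k ∧ (s₁ : ℤ) - k ≤ 2 ^ (s₂ + k) - 2 ^ s₂} =
      {k : ℕ | 0 < k ∧ s₁ + 2 ^ s₂ ≤ 2 ^ (s₂ + k) + k} := by
    ext k
    simp only [Set.mem_ofPred_eq]
    zify
    exact and_congr_right fun _ => ⟨fun h => by linarith, fun h => by linarith⟩
  have case_one : ∀ k₁ : ℕ, IsLeast {k : ℕ | 0 < k ∧ s₁ + t₁ + s₂ + 1 ≤ 2 ^ k + k} k₁ →
      (k₁ ≤ s₂ ∨ t₁ + 1 ≤ 2 ^ s₂) → (thresholdDimension G : ℤ) = ((t₂ : ℤ) - 1) + k₁ := by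
    intro k₁ hk h
    obtain ⟨a, c, hac, rfl⟩ := exists_isFeasible_of_isLeast hk h hs₂
    rw [hf.thresholdDimension_eq ht₂ hac fun a' b' c' h' => hk.2
      ⟨h'.pos hs₂, by have := h'.total; omega⟩]
    push_cast
    ring
  refine ⟨fun k₁ hk h => ?_, fun k₂ ht hk => ?_, fun k₂ ht hm hk => ?_, ?_⟩
  · rw [set_one] at hk
    exact case_one k₁ hk (h.imp_right int_le_two_pow_sub_one_iff.1)
  · rw [set_two] at hk
    have ht' : 2 ^ s₂ ≤ t₁ + 1 := by zify; linarith
    rw [hf.thresholdDimension_eq ht₂ (isFeasible_of_isLeast ht' hs₁ hk)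
      fun a' b' c' h' => h'.le_of_isLeast ht' hs₁ hk, hm₁]
    push_cast [ht']
    ring
  · have ht' : t₁ + 1 ≤ 2 ^ s₂ := by zify; linarith
    have hm' : 2 ^ s₂ < s₁ + t₁ + 1 := by zify; linarith
    rw [add_assoc, ← Nat.cast_add]
    -- Substituting `m₂` turns the condition on `k₂` into that of case (i) at `s₂ + k₂`; `m₂ < s₁`
    -- excludes candidates up to `s₂`.
    refine case_one (s₂ + k₂) ⟨⟨by omega, ?_⟩, fun k hk' => ?_⟩ (Or.inr ht')
    · have := hk.1.2
      rw [hm₂] at this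
      zify
      linarith
    · obtain ⟨hk0, hk1⟩ := hk'
      have hlt : s₂ < k := by
        by_contra! hle
        have : 2 ^ k ≤ 2 ^ s₂ := Nat.pow_le_pow_right (by omega) hle
        omega
      obtain ⟨e, rfl⟩ : ∃ e, k = s₂ + (e + 1) := ⟨k - s₂ - 1, by omega⟩
      have := hk.2 (show e + 1 ∈ _ from ⟨by omega, by
        rw [hm₂]
        zify at hk1
        push_cast
        linarith⟩)
      omega
  · have hpow : (2 : ℤ) ^ s₂ ≤ 2 ^ (s₂ + s₁) := pow_le_pow_right₀ (by norm_num) (by omega)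
    by_cases ht : (t₁ : ℤ) ≥ 2 ^ s₂ - 1
    · exact Or.inr (Or.inl ⟨ht, exists_isLeast_of_sub_le ⟨s₁, hs₁, by linarith⟩⟩)
    push Not at ht
    by_cases hm : m₂ < (s₁ : ℤ)
    · exact Or.inr (Or.inr ⟨ht, hm, exists_isLeast_of_sub_le ⟨s₁, hs₁, by linarith⟩⟩)
    push Not at hm
    -- Now `s₁ ≤ m₂`, which says exactly that `s₂` is a candidate for `k₁`.
    have hmem : 0 < s₂ ∧ (s₁ : ℤ) + t₁ + s₂ - s₂ ≤ 2 ^ s₂ - 1 := ⟨hs₂, by linarith⟩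
    obtain ⟨k₁, hk₁⟩ := exists_isLeast_of_sub_le (N := (s₁ : ℤ) + t₁ + s₂)
      (p := fun k => 2 ^ k - 1) ⟨s₂, hmem⟩
    exact Or.inl ⟨k₁, hk₁.2 hmem, hk₁⟩
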